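/- Let $\mathcal M$ be the set of standard monotone functions, i.e. functions $f:(0,\infty)\to(0,\infty)$ that are matrix monotone ($0<A\le B$ implies $f(A)\le f(B)$ for complex Hermitian matrices of every size), satisfy $f(1)=1$, and satisfy $f(x)=x f(x^{-1})$. A state $\pi$ is a positive definite complex $n\times n$ matrix of trace $1$, with $n$ arbitrary. With $\mathbb L_\pi[A]=\pi A$ and $\mathbb R_\pi[A]=A\pi$, put $$\mathbb J_f|_\pi := \mathbb R_\pi\, f(\mathbb L_\pi\mathbb R_\pi^{-1}),$$ an invertible linear map on $n\times n$ matrices, with inverse $\mathbb J_f^{-1}|_\pi$. Let $\mathcal M^{+}$ (resp. $\mathcal M^{-}$) be the set of $f\in\mathcal M$ such that $\mathbb J_f|_\pi$ (resp. $\mathbb J_f^{-1}|_\pi$) is completely positive for every state $\pi$ of every dimension. Write $f_1\preceq f_2$ if $t\mapsto f_1(e^t)/f_2(e^t)$ is a continuous positive definite function on $\mathbb R$, write $f_{SQ}(x)=\sqrt x$, and let $[Tf](x)=x/f(x)$. A measure on $\mathbb R$ is symmetric if it is invariant under $s\mapsto -s$. **Theorem.** 1. For $f\in\mathcal M$: $f\in\mathcal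 M^{+}$ if and only if $f\preceq f_{SQ}$, and $f\in\mathcal M^{-}$ if and only if $f_{SQ}\preceq f$. 2. For every $f\in\mathcal M^{+}$ there is a unique symmetric probability measure $\nu^+_f$ on $\mathbb R$ such that, for all $n$, all states $\pi$ and all $n\times n$ matrices $A$, $$\mathbb J_f|_\pi[A]=\int_{-\infty}^{\infty} d\nu^+_f(s)\;\pi^{is+\frac12}\,A\,\pi^{-is+\frac12}.$$ 3. For every $f\in\mathcal M^{-}$ there is a unique symmetric probability measure $\nu^-_f$ on $\mathbb R$ such that, for all $n$, all states $\pi$ and all $n\times n$ matrices $A$, $$\mathbb J_f^{-1}|_\pi[A]=\int_{-\infty}^{\infty} d\nu^-_f(s)\;\pi^{is-\frac12}\,A\,\pi^{-is-\frac12}.$$ 4. If $f\in\mathcal M^{+}$, then $Tf\in\mathcal M^{-}$ and $\nu^+_f=\nu^-_{Tf}$. The integrands are integrable in parts 2 and 3. -/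

import Mathlib

open MeasureTheory
open scoped ComplexOrder MatrixOrder Matrix.Norms.L2Operator CStarAlgebra

namespace QFisher

/-- Complex `n × n` matrices, with the operator norm (a C⋆-algebra) and the Loewner order. -/
abbrev Mat (n : ℕ) : Type := Matrix (Fin n) (Fin n) ℂ

/-- Linear maps on `n × n` matrices. -/
abbrev SuperOp (n : ℕ) : Type := Module.End ℂ (Mat n)

/-- A full-rank quantum state (positive definite density matrix). -/
structure IsState {n : ℕ} (π : Mat n) : Prop where
  posDef : π.PosDef
  trace_eq_one : π.trace = 1

/-- The set `𝓜` of standard monotone functions `f : (0, ∞) → (0, ∞)`.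
Only the values of `f` on `(0, ∞)` matter. -/
structure IsStandardMonotone (f : ℝ → ℝ) : Prop where
  pos : ∀ x : ℝ, 0 < x → 0 < f x
  matrixMonotone : ∀ (n : ℕ) (A B : Mat n), A.PosDef → B.PosDef → A ≤ B → cfc f A ≤ cfc f B
  map_one : f 1 = 1
  symm : ∀ x : ℝ, 0 < x → f x = x * f x⁻¹

/-- The transformation `[Tf](x) = x / f(x)`. -/
noncomputable def T (f : ℝ → ℝ) : ℝ → ℝ := fun x => x / f x

/-- `g(S)` for a superoperator `S` that is self-adjoint for the Hilbert-Schmidt inner product: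
the functional calculus of the matrix of `S` in the orthonormal basis of matrix units. -/
noncomputable def superFun {n : ℕ} (g : ℝ → ℝ) (S : SuperOp n) : SuperOp n :=
  (LinearMap.toMatrixAlgEquiv (Matrix.stdBasis ℂ (Fin n) (Fin n))).symm
    (cfc g (LinearMap.toMatrixAlgEquiv (Matrix.stdBasis ℂ (Fin n) (Fin n)) S))

/-- The modular operator `𝕃_π ℝ_π⁻¹ : A ↦ π A π⁻¹`. -/
noncomputable def modularOp {n : ℕ} (π : Mat n) : SuperOp n :=
  LinearMap.mulLeft ℂ π * LinearMap.mulRight ℂ π⁻¹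

/-- The quantum Fisher operator `𝕁_f|_π = ℝ_π f(𝕃_π ℝ_π⁻¹)`. -/
noncomputable def fisherOp {n : ℕ} (f : ℝ → ℝ) (π : Mat n) : SuperOp n :=
  LinearMap.mulRight ℂ π * superFun f (modularOp π)

/-- The inverse `𝕁_f⁻¹|_π` of the quantum Fisher operator, taken in the algebra of
superoperators (`𝕁_f|_π` is invertible by `isUnit_fisherOp` below). -/
noncomputable def fisherOpInv {n : ℕ} (f : ℝ → ℝ) (π : Mat n) : SuperOp n :=
  Ring.inverse (fisherOp f π)

/-- Complete positivity of a linear map on matrices. -/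
def IsCP {n : ℕ} (Φ : SuperOp n) : Prop :=
  ∃ Ψ : Mat n →CP Mat n, Ψ.toLinearMap = Φ

/-- `f ∈ 𝓜⁺`. -/
def MemMPlus (f : ℝ → ℝ) : Prop :=
  IsStandardMonotone f ∧ ∀ (n : ℕ) (π : Mat n), IsState π → IsCP (fisherOp f π)

/-- `f ∈ 𝓜⁻`. -/
def MemMMinus (f : ℝ → ℝ) : Prop :=
  IsStandardMonotone f ∧ ∀ (n : ℕ) (π : Mat n), IsState π → IsCP (fisherOpInv f π)

/-- Continuous positive definite functions on `ℝ`. -/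
structure IsPosDefFun (h : ℝ → ℂ) : Prop where
  continuous : Continuous h
  posSemidef : ∀ (n : ℕ) (t : Fin n → ℝ),
    (Matrix.of fun i j => h (t i - t j) : Matrix (Fin n) (Fin n) ℂ).PosSemidef

/-- The order `f₁ ⪯ f₂`: the function `t ↦ f₁(eᵗ) / f₂(eᵗ)` is positive definite. -/
def Precedes (f₁ f₂ : ℝ → ℝ) : Prop :=
  IsPosDefFun fun t => ((f₁ (Real.exp t) / f₂ (Real.exp t) : ℝ) : ℂ)

/-- The power `π ^ w` with complex exponent of a positive definite matrix. -/
noncomputable def cpow {n : ℕ} (π : Mat n) (w : ℂ) : Mat n :=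
  cfc (fun z : ℂ => z ^ w) π

/-- A probability measure on `ℝ` that is invariant under `s ↦ -s`. -/
structure IsSymmProb (ν : Measure ℝ) : Prop where
  isProb : IsProbabilityMeasure ν
  symm : ν.map (fun s => -s) = ν

/-- `𝕁_f|_π[A] = ∫ π^{is+1/2} A π^{-is+1/2} dν(s)` for all states `π` and all `A`. -/
def RepresentsPlus (f : ℝ → ℝ) (ν : Measure ℝ) : Prop :=
  ∀ (n : ℕ) (π : Mat n), IsState π → ∀ A : Mat n,
    Integrable (fun s : ℝ =>
      cpow π (Complex.I * s + 1 / 2) * A * cpow π (-(Complex.I * s) + 1 / 2)) ν ∧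
    fisherOp f π A =
      ∫ s : ℝ, cpow π (Complex.I * s + 1 / 2) * A * cpow π (-(Complex.I * s) + 1 / 2) ∂ν

/-- `𝕁_f⁻¹|_π[A] = ∫ π^{is-1/2} A π^{-is-1/2} dν(s)` for all states `π` and all `A`. -/
def RepresentsMinus (f : ℝ → ℝ) (ν : Measure ℝ) : Prop :=
  ∀ (n : ℕ) (π : Mat n), IsState π → ∀ A : Mat n,
    Integrable (fun s : ℝ =>
      cpow π (Complex.I * s - 1 / 2) * A * cpow π (-(Complex.I * s) - 1 / 2)) ν ∧
    fisherOpInv f π A =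
      ∫ s : ℝ, cpow π (Complex.I * s - 1 / 2) * A * cpow π (-(Complex.I * s) - 1 / 2) ∂ν

open scoped Kronecker in
theorem toMatrix_modularOp {n : ℕ} (π : Mat n) :
    LinearMap.toMatrixAlgEquiv (Matrix.stdBasis ℂ (Fin n) (Fin n)) (modularOp π)
      = π ⊗ₖ (π⁻¹).transpose := by
  have hrepr : ∀ (X : Mat n) (p : Fin n × Fin n),
      (Matrix.stdBasis ℂ (Fin n) (Fin n)).repr X p = X p.1 p.2 := by
    intro X p
    simp [Matrix.stdBasis]
  ext ⟨i, j⟩ ⟨k, l⟩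
  rw [LinearMap.toMatrixAlgEquiv_apply, hrepr, Matrix.stdBasis_eq_single]
  simp [modularOp, Matrix.mul_apply, Matrix.single_apply, Finset.sum_ite_eq, ite_and]

theorem isUnit_fisherOp {n : ℕ} {f : ℝ → ℝ} (hf : ∀ x : ℝ, 0 < x → 0 < f x) {π : Mat n}
    (hπ : π.PosDef) : IsUnit (fisherOp f π) := by
  have hM : (LinearMap.toMatrixAlgEquiv (Matrix.stdBasis ℂ (Fin n) (Fin n))
      (modularOp π)).PosDef := by
    rw [toMatrix_modularOp]
    exact hπ.kronecker hπ.inv.transpose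
  have hR : IsUnit (LinearMap.mulRight ℂ π) := by
    rw [isUnit_iff_exists]
    have hu : IsUnit π.det := (Matrix.isUnit_iff_isUnit_det _).1 hπ.isUnit
    refine ⟨LinearMap.mulRight ℂ π⁻¹, ?_, ?_⟩ <;> ext1 X <;>
      simp [mul_assoc, Matrix.mul_nonsing_inv _ hu, Matrix.nonsing_inv_mul _ hu]
  refine hR.mul (IsUnit.map _ ?_)
  refine (isUnit_cfc_iff (p := IsSelfAdjoint) f _ ?_ hM.isHermitian).2 fun x hx => ?_
  · exact (Matrix.finite_real_spectrum).continuousOn f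
  · rw [hM.isHermitian.spectrum_real_eq_range_eigenvalues] at hx
    obtain ⟨i, rfl⟩ := hx
    exact (hf _ (hM.eigenvalues_pos i)).ne'

end QFisher

/-! In an eigenbasis of `π` with eigenvalues `d`, `fisherOp f π` is a Schur multiplier: the unit
`(j, k)` is scaled by `d k * f (d j / d k)`, which is `√(d j * d k) * c (log (d j) - log (d k))`
with `c t = f (exp t) / √(exp t)`. The inverse has the reciprocal factors. A Schur multiplier is
completely positive iff its matrix is positive semidefinite; a diagonal congruence removes the
square roots, and the log-differences of eigenvalues of states are arbitrary, so the condition is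
that `c` (or `1 / c`) is positive definite (`IsMultiplier.isCP_iff`).

The integral formula scales the same unit by the same square roots (inverted for the inverse) times
`charFun ν`, so `ν` represents the operator iff `charFun ν` is `c` or `1 / c`
(`IsMultiplier.represents_iff`). Existence is Bochner's theorem (`IsPosDefFun.exists_charFun_eq`),
uniqueness is injectivity of `charFun`, and symmetry of `ν` is evenness of `c`. Finally `f` and `T
f` give the same function, since `√x / T f x = f x / √x`. -/

namespace QFisher

/-! ### Bochner's theorem on the real line. -/

section Bochner

open ProbabilityTheory Filter Topology

namespace IsPosDefFun

variable {φ : ℝ → ℂ}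

theorem apply_neg (hφ : IsPosDefFun φ) (t : ℝ) : φ (-t) = star (φ t) := by
  have h := (hφ.posSemidef 2 ![0, t]).isHermitian.apply 1 0
  simpa using congrArg star h

theorem norm_le_one (hφ : IsPosDefFun φ) (h0 : φ 0 = 1) (t : ℝ) : ‖φ t‖ ≤ 1 := by
  have h := (hφ.posSemidef 2 ![0, t]).det_nonneg
  rw [Matrix.det_fin_two] at h
  simp only [Matrix.of_apply, Matrix.cons_val_zero, Matrix.cons_val_one, sub_self, h0, zero_sub,
    sub_zero, hφ.apply_neg, Complex.star_def, mul_one] at h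
  rw [mul_comm, Complex.mul_conj, Complex.normSq_eq_norm_sq] at h
  norm_cast at h
  nlinarith [norm_nonneg (φ t)]

/-- Modulation is a congruence by a diagonal unitary. It upgrades positivity of one integral of `φ`
to positivity of a whole Fourier transform. -/
theorem mul_char (hφ : IsPosDefFun φ) (x : ℝ) :
    IsPosDefFun fun t => φ t * Complex.exp (-(t * x) * Complex.I) where
  continuous := by have := hφ.continuous; fun_prop
  posSemidef n t := by
    have h := (hφ.posSemidef n t).mul_mul_conjTranspose_same
      (Matrix.diagonal fun i => Complex.exp (-(t i * x) * Complex.I))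
    convert h using 1
    ext i j
    simp only [Matrix.of_apply, Matrix.diagonal_conjTranspose, Matrix.mul_diagonal,
      Matrix.diagonal_mul, Pi.star_apply, Complex.star_def, ← Complex.exp_conj, map_mul, map_neg,
      Complex.conj_ofReal, Complex.conj_I]
    rw [mul_comm (Complex.exp _), mul_assoc, ← Complex.exp_add]
    congr 2
    push_cast
    ring

theorem sum_nonneg (hφ : IsPosDefFun φ) {n : ℕ} (t : Fin n → ℝ) :
    0 ≤ ∑ i, ∑ j, φ (t i - t j) := by
  simpa [dotProduct, Matrix.mulVec] using (hφ.posSemidef n t).dotProduct_mulVec_nonneg 1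

/-- Sample `k + 2` independent points from `μ` and average the nonnegative double sum of `φ (t i - t
j)`: diagonal terms give `1`, off-diagonal ones `J`. For large `k` the off-diagonal terms dominate,
forcing `J ≥ 0`. -/
theorem integral_prod_nonneg (hφ : IsPosDefFun φ) (h0 : φ 0 = 1) (μ : Measure ℝ)
    [IsProbabilityMeasure μ] : 0 ≤ ∫ p : ℝ × ℝ, φ (p.1 - p.2) ∂(μ.prod μ) := by
  set J := ∫ p : ℝ × ℝ, φ (p.1 - p.2) ∂(μ.prod μ) with hJ
  have hc := hφ.continuous
  have key (k : ℕ) : 0 ≤ ((k + 2 : ℕ) : ℂ) * (1 + (k + 1 : ℕ) * J) := by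
    let P : Measure (Fin (k + 2) → ℝ) := Measure.pi fun _ => μ
    have hint (i j : Fin (k + 2)) : Integrable (fun t : Fin (k + 2) → ℝ => φ (t i - t j)) P :=
      Integrable.of_bound (by fun_prop) 1 (Eventually.of_forall fun _ => hφ.norm_le_one h0 _)
    have hoff (i j : Fin (k + 2)) (hij : i ≠ j) : ∫ t, φ (t i - t j) ∂P = J := by
      have hind : IndepFun (fun t : Fin (k + 2) → ℝ => t i) (fun t => t j) P :=
        (iIndepFun_pi (μ := fun _ : Fin (k + 2) => μ) (X := fun _ x => x)
          fun _ => aemeasurable_id).indepFun hij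
      have hmap (l : Fin (k + 2)) : P.map (fun t => t l) = μ :=
        (measurePreserving_eval (fun _ : Fin (k + 2) => μ) l).map_eq
      have h2 := (indepFun_iff_map_prod_eq_prod_map_map
        (measurable_pi_apply i).aemeasurable (measurable_pi_apply j).aemeasurable).1 hind
      rw [hmap, hmap] at h2
      rw [hJ, ← h2, integral_map (by fun_prop)]
      exact (Continuous.aestronglyMeasurable (by fun_prop))
    have hsum : ∫ t, ∑ i, ∑ j, φ (t i - t j) ∂P = ((k + 2 : ℕ) : ℂ) * (1 + (k + 1 : ℕ) * J) := by
      rw [integral_finsetSum _ fun i _ => integrable_finsetSum _ fun j _ => hint i j]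
      have hrow (i : Fin (k + 2)) :
          ∫ t, ∑ j, φ (t i - t j) ∂P = 1 + (k + 1 : ℕ) * J := by
        rw [integral_finsetSum _ fun j _ => hint i j,
          ← Finset.add_sum_erase _ _ (Finset.mem_univ i),
          Finset.sum_congr rfl fun j hj => hoff i j (Finset.ne_of_mem_erase hj).symm]
        simp [h0, P]
      simp [hrow]
      ring
    rw [← hsum]
    exact integral_nonneg fun t => hφ.sum_nonneg t
  have key' (k : ℕ) : 0 ≤ 1 + (k + 1 : ℝ) * J.re ∧ (k + 1 : ℝ) * J.im = 0 := by
    have h := key k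
    rw [Complex.nonneg_iff] at h
    simp only [Complex.mul_re, Complex.mul_im, Complex.add_re, Complex.add_im, Complex.natCast_re,
      Complex.natCast_im, Complex.one_re, Complex.one_im] at h
    have hk : (0 : ℝ) < ((k + 2 : ℕ) : ℝ) := by positivity
    obtain ⟨h1, h2⟩ := h
    push_cast at h1 h2 hk
    ring_nf at h1 h2
    constructor
    · refine nonneg_of_mul_nonneg_right (a := ((k : ℝ) + 2)) ?_ hk
      linarith
    · have : ((k : ℝ) + 2) * ((k + 1 : ℝ) * J.im) = 0 := by linarith
      exact (mul_eq_zero.1 this).resolve_left hk.ne'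
  rw [Complex.nonneg_iff]
  refine ⟨?_, by simpa using ((key' 0).2).symm⟩
  by_contra! hneg
  -- For this `k` the quantity `1 + (k + 1) * J.re` is negative.
  obtain ⟨k, hk⟩ := exists_nat_gt (1 / -J.re)
  rw [div_lt_iff₀ (by linarith)] at hk
  have := (key' k).1
  nlinarith

theorem integral_gaussian_nonneg (hφ : IsPosDefFun φ) (h0 : φ 0 = 1) (v : NNReal) :
    0 ≤ ∫ z, φ z ∂(gaussianReal 0 (v + v)) := by
  have hc := hφ.continuous
  have h := hφ.integral_prod_nonneg h0 (gaussianReal 0 v)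
  -- The difference of two independent centred Gaussians has the doubled variance `v + v`.
  have hlaw : ((gaussianReal 0 v).prod (gaussianReal 0 v)).map (fun p : ℝ × ℝ => p.1 - p.2)
      = gaussianReal 0 (v + v) := by
    have h1 : (gaussianReal 0 v).map (fun x => -x) = gaussianReal 0 v := by
      simpa using gaussianReal_map_neg (μ := 0) (v := v)
    have h2 := gaussianReal_conv_gaussianReal (m₁ := 0) (m₂ := 0) (v₁ := v) (v₂ := v)
    rw [add_zero] at h2
    rw [← h2]
    nth_rw 4 [← h1]
    nth_rw 3 [← Measure.map_id (μ := gaussianReal 0 v)]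
    rw [Measure.conv, Measure.map_prod_map _ _ measurable_id measurable_neg,
      Measure.map_map (by fun_prop) (by fun_prop)]
    congr 1
  rw [← hlaw, integral_map (by fun_prop) hc.aestronglyMeasurable]
  exact h

end IsPosDefFun

/-- The average of `φ` around `t` at scale `1 / r`, damped by a Gaussian factor of width `r`. -/
noncomputable def gaussianSmoothing (φ : ℝ → ℂ) (r : ℝ) (t : ℝ) : ℂ :=
  ∫ y, φ (t + y / r) * (Real.exp (-(t + y / r) ^ 2 / (4 * r ^ 2)) : ℝ) ∂(gaussianReal 0 1)

/-- The characteristic function of variance `r ^ 2` is an unnormalised Gaussian bump of width `1 /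
r` at `t`, and the density of variance `2 * r ^ 2` supplies the damping. That `C` does not depend on
`t` lets it cancel after normalisation. -/
theorem integral_mul_charFun_gaussianReal (φ : ℝ → ℂ) (hφ : Continuous φ) {r : ℝ} (hr : 0 < r) :
    ∃ C : ℝ, C ≠ 0 ∧ ∀ t : ℝ,
      ∫ z, φ z * charFun (gaussianReal 0 (.mk (r ^ 2) (sq_nonneg r))) (t - z)
        ∂(gaussianReal 0 (.mk (r ^ 2) (sq_nonneg r) + .mk (r ^ 2) (sq_nonneg r)))
      = C * gaussianSmoothing φ r t := by
  set v : NNReal := .mk (r ^ 2) (sq_nonneg r) with hv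
  have hvr : (v : ℝ) = r ^ 2 := rfl
  have hv0 : v ≠ 0 := by
    rw [← NNReal.coe_ne_zero, hvr]; positivity
  set w : NNReal := .mk ((r⁻¹) ^ 2) (sq_nonneg _) with hw
  have hwr : (w : ℝ) = (r⁻¹) ^ 2 := rfl
  have hw0 : w ≠ 0 := by
    rw [← NNReal.coe_ne_zero, hwr]; positivity
  refine ⟨(√(2 * Real.pi * (v + v)))⁻¹ * √(2 * Real.pi * w), ?_, fun t => ?_⟩
  · have h1 : 0 < v := pos_iff_ne_zero.2 hv0
    have h2 : 0 < w := pos_iff_ne_zero.2 hw0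
    positivity
  have hmap : (gaussianReal 0 1).map (fun y => t + y / r) = gaussianReal t w := by
    have h1 := gaussianReal_map_const_mul (μ := 0) (v := 1) r⁻¹
    have h2 := gaussianReal_map_const_add (μ := 0) (v := w) t
    rw [mul_zero, mul_one] at h1
    rw [zero_add, hw, ← h1, Measure.map_map (by fun_prop) (by fun_prop)] at h2
    rw [hw, ← h2]
    congr 1
    ext y
    simp [div_eq_inv_mul]
  have hsm : gaussianSmoothing φ r t
      = ∫ z, φ z * (Real.exp (-z ^ 2 / (4 * r ^ 2)) : ℝ) ∂(gaussianReal t w) := by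
    rw [← hmap, integral_map (by fun_prop) (Continuous.aestronglyMeasurable (by fun_prop))]
    rfl
  rw [hsm, integral_gaussianReal_eq_integral_smul hw0,
    integral_gaussianReal_eq_integral_smul (by simpa using hv0), ← integral_const_mul]
  congr 1
  ext z
  have hsq : √(2 * Real.pi * w) ≠ 0 := by
    have : 0 < w := pos_iff_ne_zero.2 hw0
    positivity
  rw [charFun_gaussianReal]
  have hexp : Complex.exp ((t - z : ℝ) * (0 : ℝ) * Complex.I - v * (t - z : ℝ) ^ 2 / 2)
      = (Real.exp (-(r ^ 2 * (t - z) ^ 2 / 2)) : ℝ) := by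
    rw [Complex.ofReal_exp]
    congr 1
    simp only [show ((v : ℝ) : ℂ) = ((r ^ 2 : ℝ) : ℂ) from rfl]
    push_cast
    ring
  rw [hexp]
  simp only [gaussianPDFReal, Complex.real_smul]
  have hre : (√(2 * Real.pi * ↑(v + v)))⁻¹ * Real.exp (-(z - 0) ^ 2 / (2 * ↑(v + v)))
        * Real.exp (-(r ^ 2 * (t - z) ^ 2 / 2))
      = (√(2 * Real.pi * (v + v)))⁻¹ * √(2 * Real.pi * w) *
        ((√(2 * Real.pi * w))⁻¹ * Real.exp (-(z - t) ^ 2 / (2 * w))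
          * Real.exp (-z ^ 2 / (4 * r ^ 2))) := by
    have h3 : Real.exp (-(z - 0) ^ 2 / (2 * ↑(v + v))) * Real.exp (-(r ^ 2 * (t - z) ^ 2 / 2))
        = Real.exp (-(z - t) ^ 2 / (2 * w)) * Real.exp (-z ^ 2 / (4 * r ^ 2)) := by
      rw [← Real.exp_add, ← Real.exp_add]
      congr 1
      rw [NNReal.coe_add, hvr, hwr]
      field_simp
      ring
    rw [mul_assoc, h3, NNReal.coe_add]
    field_simp
  have := congrArg (fun a : ℝ => (a : ℂ) * φ z) hre
  push_cast at this ⊢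
  linear_combination this

namespace IsPosDefFun

variable {φ : ℝ → ℂ}

/-- The Fourier transform `q` of `φ` against a Gaussian is nonnegative and bounded by `1`, so it is
a density with respect to another Gaussian; Fubini computes the characteristic function. -/
theorem exists_charFun_eq_integral (hφ : IsPosDefFun φ) (h0 : φ 0 = 1) (v : NNReal) :
    ∃ ν : Measure ℝ, IsFiniteMeasure ν ∧ ∀ t : ℝ, charFun ν t
      = ∫ z, φ z * charFun (gaussianReal 0 v) (t - z) ∂(gaussianReal 0 (v + v)) := by
  set G := gaussianReal 0 v
  set H := gaussianReal 0 (v + v)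
  have hc := hφ.continuous
  set q : ℝ → ℂ := fun x => ∫ z, φ z * Complex.exp (-(z * x) * Complex.I) ∂H with hq
  have hnn (x : ℝ) : 0 ≤ q x :=
    (hφ.mul_char x).integral_gaussian_nonneg (by simp [h0]) v
  have hqre (x : ℝ) : (((q x).re : ℝ) : ℂ) = q x := by
    have := (Complex.nonneg_iff.1 (hnn x)).2
    apply Complex.ext <;> simp [← this]
  have hbd (x z : ℝ) : ‖φ z * Complex.exp (-(z * x) * Complex.I)‖ ≤ 1 :=
    (hφ.mul_char x).norm_le_one (by simp [h0]) z
  have hqbd (x : ℝ) : ‖q x‖ ≤ 1 := by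
    simpa [hq] using norm_integral_le_of_norm_le_const (μ := H) (Eventually.of_forall (hbd x))
  have hqm : Measurable q := by
    refine StronglyMeasurable.measurable (StronglyMeasurable.integral_prod_right
      (f := fun x z : ℝ => φ z * Complex.exp (-(z * x) * Complex.I)) ?_)
    refine Continuous.stronglyMeasurable ?_
    unfold Function.uncurry
    fun_prop
  refine ⟨G.withDensity fun x => ENNReal.ofReal (q x).re, ?_, fun t => ?_⟩
  · refine isFiniteMeasure_withDensity_ofReal (Integrable.hasFiniteIntegral (μ := G) ?_)
    refine Integrable.of_bound (by fun_prop) 1 (Eventually.of_forall fun x => ?_)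
    exact (Complex.abs_re_le_norm _).trans (hqbd x)
  rw [charFun_apply_real, integral_withDensity_eq_integral_toReal_smul (by fun_prop) (by simp)]
  have h1 (x : ℝ) : (ENNReal.ofReal (q x).re).toReal • Complex.exp (t * x * Complex.I)
      = ∫ z, φ z * Complex.exp ((t - z : ℝ) * x * Complex.I) ∂H := by
    rw [ENNReal.toReal_ofReal (Complex.nonneg_iff.1 (hnn x)).1, Complex.real_smul, hqre, hq,
      ← integral_mul_const]
    congr 1
    ext z
    rw [mul_assoc, ← Complex.exp_add]
    congr 2
    push_cast
    ring
  simp_rw [h1]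
  rw [integral_integral_swap]
  · simp_rw [integral_const_mul, charFun_apply_real]
  · refine Integrable.of_bound (Continuous.aestronglyMeasurable ?_) 1
      (Eventually.of_forall fun p => ?_)
    · unfold Function.uncurry
      fun_prop
    · simp only [Function.uncurry, norm_mul, ← Complex.ofReal_mul, Complex.norm_exp_ofReal_mul_I,
        mul_one]
      exact hφ.norm_le_one h0 _

theorem exists_charFun_eq_gaussianSmoothing (hφ : IsPosDefFun φ) (h0 : φ 0 = 1) {r : ℝ}
    (hr : 0 < r) (hne : gaussianSmoothing φ r 0 ≠ 0) :
    ∃ ν : ProbabilityMeasure ℝ, ∀ t : ℝ,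
      charFun (ν : Measure ℝ) t = gaussianSmoothing φ r t / gaussianSmoothing φ r 0 := by
  obtain ⟨C, hC, hCt⟩ := integral_mul_charFun_gaussianReal φ hφ.continuous hr
  obtain ⟨ν, hfin, hν⟩ := hφ.exists_charFun_eq_integral h0 (.mk (r ^ 2) (sq_nonneg r))
  have hν' (t : ℝ) : charFun ν t = C * gaussianSmoothing φ r t := (hν t).trans (hCt t)
  have hmass : ((ν.real Set.univ : ℝ) : ℂ) = C * gaussianSmoothing φ r 0 := by
    rw [← hν', charFun_zero]
  have hC' : (C : ℂ) ≠ 0 := by exact_mod_cast hC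
  have hne' : ν ≠ 0 := by
    rintro rfl
    simp [hC', hne] at hmass
  have : NeZero ν := ⟨hne'⟩
  refine ⟨⟨(ν Set.univ)⁻¹ • ν, inferInstance⟩, fun t => ?_⟩
  have h1 : charFun ((ν Set.univ)⁻¹ • ν) t = ((ν.real Set.univ : ℝ) : ℂ)⁻¹ * charFun ν t := by
    rw [charFun_apply, integral_smul_measure, ← charFun_apply, ENNReal.toReal_inv,
      Complex.real_smul, Complex.ofReal_inv, Measure.real]
  rw [ProbabilityMeasure.coe_mk, h1, hmass, hν']
  field_simp

theorem tendsto_gaussianSmoothing (hφ : IsPosDefFun φ) (h0 : φ 0 = 1) (t : ℝ) :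
    Tendsto (fun n : ℕ => gaussianSmoothing φ (n + 1) t) atTop (𝓝 (φ t)) := by
  have hc := hφ.continuous
  have hlim : ∫ _ : ℝ, φ t ∂(gaussianReal 0 1) = φ t := by simp
  rw [← hlim]
  refine tendsto_integral_of_dominated_convergence (fun _ => 1)
    (fun n => Continuous.aestronglyMeasurable (by fun_prop)) (integrable_const _)
    (fun n => Eventually.of_forall fun y => ?_) (Eventually.of_forall fun y => ?_)
  · rw [norm_mul, Complex.norm_real, Real.norm_of_nonneg (Real.exp_nonneg _)]
    refine mul_le_one₀ (hφ.norm_le_one h0 _) (Real.exp_nonneg _) (Real.exp_le_one_iff.2 ?_)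
    exact div_nonpos_of_nonpos_of_nonneg (by simp [sq_nonneg]) (by positivity)
  · have hn : Tendsto (fun n : ℕ => ((n : ℝ) + 1)) atTop atTop :=
      tendsto_atTop_add_const_right _ _ tendsto_natCast_atTop_atTop
    have h1 : Tendsto (fun n : ℕ => t + y / ((n : ℝ) + 1)) atTop (𝓝 t) := by
      simpa using (hn.const_div_atTop y).const_add t
    have h2 : Tendsto (fun n : ℕ => -(t + y / ((n : ℝ) + 1)) ^ 2 / (4 * ((n : ℝ) + 1) ^ 2))
        atTop (𝓝 0) :=
      (h1.pow 2).neg.div_atTop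
        (((tendsto_pow_atTop two_ne_zero).comp hn).const_mul_atTop (by norm_num))
    have h3 := ((hc.tendsto t).comp h1).mul
      ((Complex.continuous_ofReal.tendsto _).comp ((Real.continuous_exp.tendsto _).comp h2))
    simpa using h3

/-- **Bochner's theorem** on the real line. -/
theorem exists_charFun_eq (hφ : IsPosDefFun φ) (h0 : φ 0 = 1) :
    ∃ ν : Measure ℝ, IsProbabilityMeasure ν ∧ charFun ν = φ := by
  have hlim := hφ.tendsto_gaussianSmoothing h0
  have hev : ∀ᶠ n : ℕ in atTop, gaussianSmoothing φ (n + 1) 0 ≠ 0 :=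
    (hlim 0).eventually_ne (by simp [h0])
  obtain ⟨N, hN⟩ := eventually_atTop.1 hev
  choose ν hν using fun n : ℕ => hφ.exists_charFun_eq_gaussianSmoothing h0
    (r := ((n + N : ℕ) : ℝ) + 1) (by positivity) (hN _ (by lia))
  have hconv (t : ℝ) : Tendsto (fun n => charFun (ν n : Measure ℝ) t) atTop (𝓝 (φ t)) := by
    have h := ((hlim t).div (hlim 0) (by simp [h0])).comp (tendsto_add_atTop_nat N)
    rw [h0, div_one] at h
    exact h.congr fun n => (hν n t).symm
  -- Lévy's criterion: the pointwise limit of the characteristic functions is continuous at `0`.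
  have htight : IsTightMeasureSet (Set.range fun n => (ν n : Measure ℝ)) :=
    isTightMeasureSet_of_tendsto_charFun hφ.continuous.continuousAt hconv
  have hcompact : IsCompact (closure (Set.range ν)) := by
    refine isCompact_closure_of_isTightMeasureSet ?_
    convert htight
    ext m
    simp
  -- An ultrafilter replaces extraction of a convergent subsequence.
  let U : Ultrafilter ℕ := Ultrafilter.of atTop
  obtain ⟨μ, -, hμ⟩ := hcompact.ultrafilter_le_nhds (U.map ν)
    (le_principal_iff.2 (Filter.mem_map.2 (univ_mem' fun n => subset_closure ⟨n, rfl⟩)))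
  refine ⟨μ, inferInstance, funext fun t => ?_⟩
  have hμ' : Tendsto ν U (𝓝 μ) := hμ
  rw [ProbabilityMeasure.tendsto_iff_forall_integral_rclike_tendsto ℂ] at hμ'
  have h1 := hμ' (BoundedContinuousFunction.innerProbChar t)
  simp_rw [← charFun_eq_integral_innerProbChar] at h1
  exact tendsto_nhds_unique h1 ((hconv t).mono_left (Ultrafilter.of_le _))

end IsPosDefFun

end Bochner

/-! ### Functional calculus on finite spectra by interpolation. -/

section FunctionalCalculus

open Polynomial

/-- Lagrange interpolation on the spectrum together with `s`. Enlarging the node set by `s` avoids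
having to show that given eigenvalues lie in the spectrum. -/
theorem exists_polynomial_cfc_eq {𝕜 A : Type*} {P : A → Prop} [RCLike 𝕜] [Ring A] [StarRing A]
    [TopologicalSpace A] [Algebra 𝕜 A] [ContinuousFunctionalCalculus 𝕜 A P] (g : 𝕜 → 𝕜) {a : A}
    (ha : P a) (hfin : (spectrum 𝕜 a).Finite) (s : Finset 𝕜) :
    ∃ p : 𝕜[X], cfc g a = aeval a p ∧ ∀ x ∈ s, p.eval x = g x := by
  classical
  let t := hfin.toFinset ∪ s
  have ht (x) (hx : x ∈ t) : (Lagrange.interpolate t id g).eval x = g x :=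
    Lagrange.eval_interpolate_at_node (v := id) g (Set.injOn_id _) hx
  refine ⟨Lagrange.interpolate t id g, ?_, fun x hx => ht x (Finset.mem_union_right _ hx)⟩
  rw [← cfc_polynomial _ a ha]
  exact cfc_congr fun x hx => (ht x (Finset.mem_union_left _ (hfin.mem_toFinset.2 hx))).symm

theorem aeval_apply_of_apply_eq_smul {V : Type*} [AddCommGroup V] [Module ℂ V]
    {S : Module.End ℂ V} {x : V} {μ : ℂ} (h : S x = μ • x) (p : ℂ[X]) :
    aeval S p x = p.eval μ • x := by
  by_cases hx : x = 0
  · simp [hx]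
  · exact Module.End.aeval_apply_of_hasEigenvector ⟨Module.End.mem_eigenspace_iff.2 h, hx⟩

theorem superFun_apply {n : ℕ} (g : ℝ → ℝ) {S : SuperOp n}
    (hS : (LinearMap.toMatrixAlgEquiv (Matrix.stdBasis ℂ (Fin n) (Fin n)) S).IsHermitian)
    {X : Mat n} {μ : ℝ} (h : S X = (μ : ℂ) • X) : superFun g S X = (g μ : ℂ) • X := by
  obtain ⟨p, hp, hpμ⟩ := exists_polynomial_cfc_eq (P := IsSelfAdjoint) g hS
    Matrix.finite_real_spectrum {μ}
  rw [superFun, hp, ← aeval_map_algebraMap ℂ, ← aeval_algHom_apply, AlgEquiv.symm_apply_apply,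
    aeval_apply_of_apply_eq_smul h, ← hpμ μ (by simp)]
  congr 1
  rw [eval_map_algebraMap, ← Complex.coe_algebraMap, aeval_algebraMap_apply, coe_aeval_eq_eval]

/-- Conjugation `X ↦ U X U*` by a unitary matrix. -/
noncomputable abbrev conj {n : ℕ} (U : unitary (Mat n)) : Mat n ≃⋆ₐ[ℂ] Mat n :=
  Unitary.conjStarAlgAut ℂ (Mat n) U

theorem aeval_conj_diagonal {n : ℕ} (U : unitary (Mat n)) (d : Fin n → ℂ) (p : ℂ[X]) :
    aeval (conj U (Matrix.diagonal d)) p = conj U (Matrix.diagonal fun i => p.eval (d i)) := by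
  rw [aeval_algHom_apply]
  congr 1
  have h := aeval_algHom_apply (Matrix.diagonalAlgHom (n := Fin n) ℂ) d p
  rw [aeval_pi] at h
  exact h

theorem cfc_complex_conj_diagonal {n : ℕ} (U : unitary (Mat n)) (d : Fin n → ℂ) (g : ℂ → ℂ) :
    cfc g (conj U (Matrix.diagonal d)) = conj U (Matrix.diagonal fun i => g (d i)) := by
  have hN : IsStarNormal (Matrix.diagonal d) := by
    refine ⟨?_⟩
    rw [Matrix.star_eq_conjTranspose, Matrix.diagonal_conjTranspose]
    exact Matrix.commute_diagonal _ _
  obtain ⟨p, hp, hpd⟩ := exists_polynomial_cfc_eq (P := IsStarNormal) g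
    (hN.map (conj U)) (Matrix.finite_spectrum _) (Finset.univ.image d)
  rw [hp, aeval_conj_diagonal]
  congr 2
  ext i
  exact hpd _ (Finset.mem_image_of_mem _ (Finset.mem_univ i))

theorem cfc_real_conj_diagonal {n : ℕ} (U : unitary (Mat n)) (d : Fin n → ℝ) (g : ℝ → ℝ) :
    cfc g (conj U (Matrix.diagonal fun i => (d i : ℂ)))
      = conj U (Matrix.diagonal fun i => (g (d i) : ℂ)) := by
  have hN : IsSelfAdjoint (Matrix.diagonal fun i => (d i : ℂ)) := by
    rw [IsSelfAdjoint, Matrix.star_eq_conjTranspose, Matrix.diagonal_conjTranspose]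
    congr 1
    ext i
    simp
  obtain ⟨p, hp, hpd⟩ := exists_polynomial_cfc_eq (P := IsSelfAdjoint) g
    (hN.map (conj U)) Matrix.finite_real_spectrum (Finset.univ.image d)
  rw [hp, ← aeval_map_algebraMap ℂ, aeval_conj_diagonal]
  congr 2
  ext i
  rw [← hpd _ (Finset.mem_image_of_mem _ (Finset.mem_univ i)), eval_map_algebraMap,
    ← Complex.coe_algebraMap, aeval_algebraMap_apply, coe_aeval_eq_eval]

end FunctionalCalculus

/-! ### Action on matrix units in an eigenbasis of the state. -/

section Spectral

open Matrix (single diagonal)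

variable {n : ℕ} {U : unitary (Mat n)} {d : Fin n → ℝ}

/-- The Hermitian matrix with eigenvalues `d` and eigenvectors the columns of `U`. -/
noncomputable def ofSpectrum (U : unitary (Mat n)) (d : Fin n → ℝ) : Mat n :=
  conj U (diagonal fun i => (d i : ℂ))

theorem exists_eq_ofSpectrum {π : Mat n} (hπ : π.PosDef) :
    ∃ (U : unitary (Mat n)) (d : Fin n → ℝ), (∀ i, 0 < d i) ∧ π = ofSpectrum U d :=
  ⟨hπ.isHermitian.eigenvectorUnitary, hπ.isHermitian.eigenvalues, hπ.eigenvalues_pos,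
    hπ.isHermitian.spectral_theorem⟩

theorem posDef_ofSpectrum (U : unitary (Mat n)) (hd : ∀ i, 0 < d i) : (ofSpectrum U d).PosDef := by
  have h : (diagonal fun i => (d i : ℂ)).PosDef :=
    Matrix.PosDef.diagonal fun i => by exact_mod_cast hd i
  have hU : IsUnit (U : Mat n) := (Unitary.toUnits U).isUnit
  rw [ofSpectrum, Unitary.conjStarAlgAut_apply]
  exact (Matrix.IsUnit.posDef_star_right_conjugate_iff hU).2 h

theorem isState_ofSpectrum (U : unitary (Mat n)) (hd : ∀ i, 0 < d i) (hsum : ∑ i, d i = 1) :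
    IsState (ofSpectrum U d) where
  posDef := posDef_ofSpectrum U hd
  trace_eq_one := by
    rw [ofSpectrum, Unitary.conjStarAlgAut_apply, Matrix.trace_mul_cycle, Unitary.coe_star_mul_self,
      one_mul, Matrix.trace_diagonal]
    exact_mod_cast hsum

theorem inv_ofSpectrum (U : unitary (Mat n)) (hd : ∀ i, 0 < d i) :
    (ofSpectrum U d)⁻¹ = ofSpectrum U fun i => (d i)⁻¹ := by
  refine Matrix.inv_eq_right_inv ?_
  rw [ofSpectrum, ofSpectrum, ← map_mul, Matrix.diagonal_mul_diagonal, ← map_one (conj U),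
    ← Matrix.diagonal_one]
  congr 2
  ext i
  have := (hd i).ne'
  push_cast
  field_simp

theorem cpow_ofSpectrum (U : unitary (Mat n)) (d : Fin n → ℝ) (w : ℂ) :
    cpow (ofSpectrum U d) w = conj U (diagonal fun i => (d i : ℂ) ^ w) :=
  cfc_complex_conj_diagonal U _ _

theorem diagonal_mul_single_mul_diagonal (a b : Fin n → ℂ) (j k : Fin n) :
    diagonal a * single j k (1 : ℂ) * diagonal b = (a j * b k) • single j k (1 : ℂ) := by
  ext l m
  simp only [Matrix.mul_diagonal, Matrix.diagonal_mul, Matrix.smul_apply, Matrix.single_apply,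
    smul_eq_mul]
  split_ifs with h
  · rw [h.1, h.2]; ring
  · ring

/-- The matrix units in the basis of the columns of `U`. -/
noncomputable def unitOf (U : unitary (Mat n)) (j k : Fin n) : Mat n := conj U (single j k 1)

theorem conj_diagonal_mul_unitOf_mul (a b : Fin n → ℂ) (j k : Fin n) :
    conj U (diagonal a) * unitOf U j k * conj U (diagonal b) = (a j * b k) • unitOf U j k := by
  rw [unitOf, ← map_mul, ← map_mul, diagonal_mul_single_mul_diagonal, map_smul]

theorem induction_unitOf (U : unitary (Mat n)) {P : Mat n → Prop} (A : Mat n)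
    (unit : ∀ j k, P (unitOf U j k)) (zero : P 0) (add : ∀ X Y, P X → P Y → P (X + Y))
    (smul : ∀ (c : ℂ) X, P X → P (c • X)) : P A := by
  obtain ⟨B, rfl⟩ := (conj U).surjective A
  rw [Matrix.matrix_eq_sum_single B, map_sum]
  refine Finset.sum_induction _ P add zero fun j _ => ?_
  rw [map_sum]
  refine Finset.sum_induction _ P add zero fun k _ => ?_
  have : single j k (B j k) = B j k • single j k (1 : ℂ) := by simp
  have h : P (conj U (single j k (B j k))) := by
    rw [this, map_smul]
    exact smul _ _ (unit j k)
  exact h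

theorem modularOp_unitOf (hd : ∀ i, 0 < d i) (j k : Fin n) :
    modularOp (ofSpectrum U d) (unitOf U j k) = ((d j / d k : ℝ) : ℂ) • unitOf U j k := by
  have h : modularOp (ofSpectrum U d) (unitOf U j k)
      = ofSpectrum U d * unitOf U j k * (ofSpectrum U d)⁻¹ := by
    simp [modularOp, mul_assoc]
  rw [h, inv_ofSpectrum U hd, ofSpectrum, ofSpectrum, conj_diagonal_mul_unitOf_mul]
  congr 1
  push_cast
  rw [div_eq_mul_inv]

theorem fisherOp_unitOf (f : ℝ → ℝ) (hd : ∀ i, 0 < d i) (j k : Fin n) :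
    fisherOp f (ofSpectrum U d) (unitOf U j k)
      = ((d k * f (d j / d k) : ℝ) : ℂ) • unitOf U j k := by
  have hπ := posDef_ofSpectrum U hd
  have hM : (LinearMap.toMatrixAlgEquiv (Matrix.stdBasis ℂ (Fin n) (Fin n))
      (modularOp (ofSpectrum U d))).IsHermitian := by
    rw [toMatrix_modularOp]
    exact (hπ.kronecker hπ.inv.transpose).isHermitian
  have h1 : unitOf U j k * ofSpectrum U d = (d k : ℂ) • unitOf U j k := by
    have := conj_diagonal_mul_unitOf_mul (U := U) 1 (fun i => (d i : ℂ)) j k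
    rwa [show (diagonal (1 : Fin n → ℂ)) = 1 from Matrix.diagonal_one, map_one, one_mul,
      Pi.one_apply, one_mul] at this
  rw [fisherOp, Module.End.mul_apply, superFun_apply f hM (modularOp_unitOf hd j k), map_smul,
    LinearMap.mulRight_apply, h1, smul_smul]
  congr 1
  push_cast
  ring

theorem fisherOpInv_unitOf {f : ℝ → ℝ} (hf : ∀ x : ℝ, 0 < x → 0 < f x) (hd : ∀ i, 0 < d i)
    (j k : Fin n) :
    fisherOpInv f (ofSpectrum U d) (unitOf U j k)
      = (((d k * f (d j / d k))⁻¹ : ℝ) : ℂ) • unitOf U j k := by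
  have hu := isUnit_fisherOp hf (posDef_ofSpectrum U hd)
  have hne : ((d k * f (d j / d k) : ℝ) : ℂ) ≠ 0 := by
    exact_mod_cast (mul_pos (hd k) (hf _ (div_pos (hd j) (hd k)))).ne'
  have h := congrArg (fun Φ : SuperOp n => Φ (unitOf U j k)) (Ring.inverse_mul_cancel _ hu)
  simp only [Module.End.mul_apply, fisherOp_unitOf f hd, map_smul, Module.End.one_apply] at h
  rw [fisherOpInv, Complex.ofReal_inv, eq_inv_smul_iff₀ hne]
  exact h

end Spectral

/-! ### Completely positive Schur multipliers. -/

section CompletePositivity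

open Matrix (single diagonal)

variable {n : ℕ}

theorem IsCP.zero : IsCP (0 : SuperOp n) :=
  ⟨{ (0 : SuperOp n) with
     map_cstarMatrix_nonneg' := fun _ _ _ => le_of_eq (CStarMatrix.ext fun _ _ => rfl) }, rfl⟩

theorem IsCP.add {Φ₁ Φ₂ : SuperOp n} (h₁ : IsCP Φ₁) (h₂ : IsCP Φ₂) : IsCP (Φ₁ + Φ₂) := by
  obtain ⟨Ψ₁, rfl⟩ := h₁
  obtain ⟨Ψ₂, rfl⟩ := h₂
  refine ⟨{ Ψ₁.toLinearMap + Ψ₂.toLinearMap with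
    map_cstarMatrix_nonneg' := fun k M hM => ?_ }, rfl⟩
  exact (add_nonneg (Ψ₁.map_cstarMatrix_nonneg' k M hM)
    (Ψ₂.map_cstarMatrix_nonneg' k M hM)).trans_eq (CStarMatrix.ext fun _ _ => rfl)

/-- Each amplification is conjugation by the block-diagonal matrix with blocks `K`. -/
theorem isCP_mul_mul_star (K : Mat n) :
    IsCP (LinearMap.mulLeft ℂ K * LinearMap.mulRight ℂ (star K)) := by
  refine ⟨{ LinearMap.mulLeft ℂ K * LinearMap.mulRight ℂ (star K) with
    map_cstarMatrix_nonneg' := fun k M hM => ?_ }, rfl⟩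
  let D : CStarMatrix (Fin k) (Fin k) (Mat n) := CStarMatrix.ofMatrix (diagonal fun _ => K)
  refine (star_right_conjugate_nonneg hM D).trans_eq (CStarMatrix.ext fun i j => ?_)
  have hD (i j) : D i j = if i = j then K else 0 := by
    simp [D, Matrix.diagonal_apply]
  have h0 (l j : Fin k) : star (if j = l then K else 0) = if l = j then star K else 0 := by
    split_ifs with h1 h2 h2 <;> simp_all
  simp only [CStarMatrix.mul_apply, CStarMatrix.star_apply, hD, CStarMatrix.map_apply, h0]
  simp [mul_assoc]

theorem IsCP.map_nonneg {Φ : SuperOp n} (h : IsCP Φ) {X : Mat n} (hX : 0 ≤ X) : 0 ≤ Φ X := by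
  obtain ⟨Ψ, rfl⟩ := h
  have := OrderHomClass.mono Ψ hX
  rwa [map_zero Ψ] at this

/-- Factoring `C = B* B` yields a Kraus decomposition whose operators are diagonal in the
eigenbasis, one for each row of `B`. -/
theorem isCP_of_unitOf {Φ : SuperOp n} {U : unitary (Mat n)} {C : Mat n} (hC : C.PosSemidef)
    (h : ∀ j k, Φ (unitOf U j k) = C j k • unitOf U j k) : IsCP Φ := by
  obtain ⟨B, hB⟩ := CStarAlgebra.nonneg_iff_eq_star_mul_self.1 hC.nonneg
  let K (l : Fin n) : Mat n := conj U (diagonal (star (B l)))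
  have hK (l : Fin n) : star (K l) = conj U (diagonal (B l)) := by
    rw [← map_star, Matrix.star_eq_conjTranspose, Matrix.diagonal_conjTranspose, star_star]
  have hΦ : Φ = ∑ l, LinearMap.mulLeft ℂ (K l) * LinearMap.mulRight ℂ (star (K l)) := by
    ext1 A
    induction A using induction_unitOf U with
    | unit j k =>
      have hl (l : Fin n) : (LinearMap.mulLeft ℂ (K l) * LinearMap.mulRight ℂ (star (K l)))
          (unitOf U j k) = (star (B l j) * B l k) • unitOf U j k := by
        rw [Module.End.mul_apply, LinearMap.mulLeft_apply, LinearMap.mulRight_apply, hK,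
          ← mul_assoc, conj_diagonal_mul_unitOf_mul, Pi.star_apply]
      rw [h, LinearMap.sum_apply, Finset.sum_congr rfl fun l _ => hl l, ← Finset.sum_smul, hB,
        Matrix.mul_apply]
      rfl
    | zero => simp
    | add X Y hX hY => rw [map_add, map_add, hX, hY]
    | smul c X hX => rw [map_smul, map_smul, hX]
  rw [hΦ]
  exact Finset.sum_induction _ IsCP (fun _ _ => IsCP.add) IsCP.zero
    fun l _ => isCP_mul_mul_star (K l)

end CompletePositivity

/-! ### Complete positivity and integral representations of multipliers. -/

section Multiplier

open Matrix (single diagonal)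

/-- In an eigenbasis of `π` with eigenvalues `d`, the superoperator `Φ π` multiplies the `(j, k)`
entry by `(d j * d k) ^ a * c (log (d j) - log (d k))`. -/
def IsMultiplier (Φ : (n : ℕ) → Mat n → SuperOp n) (a : ℝ) (c : ℝ → ℝ) : Prop :=
  ∀ (n : ℕ) (U : unitary (Mat n)) (d : Fin n → ℝ), (∀ i, 0 < d i) → ∀ j k,
    Φ n (ofSpectrum U d) (unitOf U j k)
      = ((d j ^ a * d k ^ a * c (Real.log (d j) - Real.log (d k)) : ℝ) : ℂ) • unitOf U j k

/-- `Φ π A = ∫ π ^ (is + a) A π ^ (-is + a) dν(s)` for all states `π` and all `A`. -/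
def Represents (Φ : (n : ℕ) → Mat n → SuperOp n) (a : ℝ) (ν : Measure ℝ) : Prop :=
  ∀ (n : ℕ) (π : Mat n), IsState π → ∀ A : Mat n,
    Integrable (fun s : ℝ =>
      cpow π (Complex.I * s + (a : ℂ)) * A * cpow π (-(Complex.I * s) + (a : ℂ))) ν ∧
    Φ n π A =
      ∫ s : ℝ, cpow π (Complex.I * s + (a : ℂ)) * A * cpow π (-(Complex.I * s) + (a : ℂ)) ∂ν

theorem sum_unitOf_one {n : ℕ} (C : Fin n → Fin n → ℂ) :
    ∑ j, ∑ k, C j k • unitOf (1 : unitary (Mat n)) j k = Matrix.of C := by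
  rw [Matrix.matrix_eq_sum_single (Matrix.of C)]
  simp [unitOf]

/-- Gibbs weights: the normalising sum cancels in differences of logarithms, so the trace condition
costs nothing. -/
theorem exists_state_eigenvalues {n : ℕ} (hn : 0 < n) (t : Fin n → ℝ) :
    ∃ d : Fin n → ℝ, (∀ i, 0 < d i) ∧ ∑ i, d i = 1 ∧
      ∀ j k, Real.log (d j) - Real.log (d k) = t j - t k := by
  have : Nonempty (Fin n) := ⟨⟨0, hn⟩⟩
  have hZ : 0 < ∑ i, Real.exp (t i) :=
    Finset.sum_pos (fun i _ => Real.exp_pos _) Finset.univ_nonempty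
  refine ⟨fun i => Real.exp (t i) / ∑ i, Real.exp (t i), fun i => div_pos (Real.exp_pos _) hZ, ?_,
    fun j k => ?_⟩
  · rw [← Finset.sum_div, div_self hZ.ne']
  · rw [Real.log_div (Real.exp_ne_zero _) hZ.ne', Real.log_div (Real.exp_ne_zero _) hZ.ne',
      Real.log_exp, Real.log_exp]
    ring

variable {Φ : (n : ℕ) → Mat n → SuperOp n} {a : ℝ} {c : ℝ → ℝ}

/-- For the forward direction, positivity of the image of the all-ones matrix suffices, since that
image is the multiplier matrix itself. -/
theorem IsMultiplier.isCP_iff (hΦ : IsMultiplier Φ a c) (hc : Continuous c) :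
    (∀ (n : ℕ) (π : Mat n), IsState π → IsCP (Φ n π)) ↔ IsPosDefFun fun t => (c t : ℂ) := by
  constructor
  · refine fun h => ⟨by fun_prop, fun n t => ?_⟩
    -- No state exists in dimension `0`, so the empty matrix is treated apart.
    obtain rfl | hn := Nat.eq_zero_or_pos n
    · rw [Subsingleton.elim (Matrix.of _) 0]
      exact Matrix.PosSemidef.zero
    obtain ⟨d, hd, hsum, hlog⟩ := exists_state_eigenvalues hn t
    have hone : (0 : Mat n) ≤ Matrix.of fun _ _ => 1 := by
      have := (Matrix.posSemidef_vecMulVec_self_star (1 : Fin n → ℂ)).nonneg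
      convert this using 1
      ext i j
      simp [Matrix.vecMulVec_apply]
    have h1 := (h n _ (isState_ofSpectrum 1 hd hsum)).map_nonneg hone
    rw [← sum_unitOf_one] at h1
    simp only [map_sum, one_smul, hΦ n 1 d hd] at h1
    rw [sum_unitOf_one, Matrix.nonneg_iff_posSemidef] at h1
    have h2 := h1.mul_mul_conjTranspose_same (diagonal fun i => ((d i ^ (-a) : ℝ) : ℂ))
    refine (congrArg Matrix.PosSemidef ?_).mpr h2
    ext j k
    rw [Matrix.diagonal_conjTranspose, Matrix.mul_diagonal, Matrix.diagonal_mul]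
    simp only [Matrix.of_apply, Pi.star_apply, Complex.star_def, Complex.conj_ofReal, hlog]
    norm_cast
    have hj : d j ^ (-a) * d j ^ a = 1 := by rw [← Real.rpow_add (hd j)]; simp
    have hk : d k ^ (-a) * d k ^ a = 1 := by rw [← Real.rpow_add (hd k)]; simp
    linear_combination (-(d k ^ (-a) * d k ^ a) * c (t j - t k)) * hj - c (t j - t k) * hk
  · intro h n π hπ
    obtain ⟨U, d, hd, rfl⟩ := exists_eq_ofSpectrum hπ.posDef
    have h1 := (h.posSemidef n fun i => Real.log (d i)).mul_mul_conjTranspose_same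
      (diagonal fun i => ((d i ^ a : ℝ) : ℂ))
    refine isCP_of_unitOf h1 (U := U) fun j k => ?_
    rw [hΦ n U d hd]
    congr 1
    rw [Matrix.diagonal_conjTranspose, Matrix.mul_diagonal, Matrix.diagonal_mul]
    simp only [Matrix.of_apply, Pi.star_apply, Complex.star_def, Complex.conj_ofReal]
    norm_cast
    ring

theorem cpow_mul_unitOf_mul_cpow {n : ℕ} (U : unitary (Mat n)) {d : Fin n → ℝ}
    (hd : ∀ i, 0 < d i) (a s : ℝ) (j k : Fin n) :
    cpow (ofSpectrum U d) (Complex.I * s + (a : ℂ)) * unitOf U j k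
        * cpow (ofSpectrum U d) (-(Complex.I * s) + (a : ℂ))
      = Complex.exp ((Real.log (d j) - Real.log (d k) : ℝ) * s * Complex.I) •
        ((d j ^ a * d k ^ a : ℝ) : ℂ) • unitOf U j k := by
  rw [cpow_ofSpectrum, cpow_ofSpectrum, conj_diagonal_mul_unitOf_mul, smul_smul]
  congr 1
  have hne (i : Fin n) : (d i : ℂ) ≠ 0 := by exact_mod_cast (hd i).ne'
  rw [Complex.cpow_add _ _ (hne j), Complex.cpow_add _ _ (hne k), Complex.ofReal_mul,
    Complex.ofReal_cpow (hd j).le, Complex.ofReal_cpow (hd k).le,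
    Complex.cpow_def_of_ne_zero (hne j) (Complex.I * s),
    Complex.cpow_def_of_ne_zero (hne k) (-(Complex.I * s)),
    ← Complex.ofReal_log (hd j).le, ← Complex.ofReal_log (hd k).le]
  have : Complex.exp ((Real.log (d j) - Real.log (d k) : ℝ) * s * Complex.I)
      = Complex.exp (Real.log (d j) * (Complex.I * s))
        * Complex.exp (Real.log (d k) * (-(Complex.I * s))) := by
    rw [← Complex.exp_add]
    congr 1
    push_cast
    ring
  rw [this]
  ring

theorem integral_cpow_mul_unitOf_mul_cpow {n : ℕ} (U : unitary (Mat n)) {d : Fin n → ℝ}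
    (hd : ∀ i, 0 < d i) (a : ℝ) (j k : Fin n) (ν : Measure ℝ) :
    ∫ s : ℝ, cpow (ofSpectrum U d) (Complex.I * s + (a : ℂ)) * unitOf U j k
        * cpow (ofSpectrum U d) (-(Complex.I * s) + (a : ℂ)) ∂ν
      = charFun ν (Real.log (d j) - Real.log (d k)) •
        ((d j ^ a * d k ^ a : ℝ) : ℂ) • unitOf U j k := by
  simp_rw [cpow_mul_unitOf_mul_cpow U hd]
  rw [integral_smul_const, charFun_apply_real]

/-- Qubit states already determine `charFun ν`: one off-diagonal unit with log-eigenvalue difference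
`t` reads off its value at `t`. -/
theorem IsMultiplier.represents_iff (hΦ : IsMultiplier Φ a c) {ν : Measure ℝ}
    [IsProbabilityMeasure ν] : Represents Φ a ν ↔ charFun ν = fun t => (c t : ℂ) := by
  constructor
  · intro h
    ext t
    obtain ⟨d, hd, hsum, hlog⟩ := exists_state_eigenvalues two_pos ![t, 0]
    have h1 := (h 2 _ (isState_ofSpectrum 1 hd hsum) (unitOf 1 0 1)).2
    rw [integral_cpow_mul_unitOf_mul_cpow 1 hd, hΦ 2 1 d hd, hlog, smul_smul] at h1
    have h2 := congrFun (congrFun h1 0) 1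
    simp only [unitOf, map_one, StarAlgEquiv.one_apply, Matrix.smul_apply, Matrix.single_apply,
      and_self, if_true, smul_eq_mul, mul_one, Matrix.cons_val_zero, Matrix.cons_val_one,
      sub_zero] at h2
    have hne : ((d 0 ^ a * d 1 ^ a : ℝ) : ℂ) ≠ 0 := by
      exact_mod_cast (mul_pos (Real.rpow_pos_of_pos (hd 0) a) (Real.rpow_pos_of_pos (hd 1) a)).ne'
    rw [Complex.ofReal_mul, mul_comm] at h2
    exact (mul_right_cancel₀ hne h2).symm
  · intro h n π hπ A
    obtain ⟨U, d, hd, rfl⟩ := exists_eq_ofSpectrum hπ.posDef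
    induction A using induction_unitOf U with
    | unit j k =>
      constructor
      · simp_rw [cpow_mul_unitOf_mul_cpow U hd]
        refine Integrable.smul_const (Integrable.of_bound
          (Continuous.aestronglyMeasurable (by fun_prop)) 1 (Filter.Eventually.of_forall
            fun s => ?_)) _
        rw [← Complex.ofReal_mul, Complex.norm_exp_ofReal_mul_I]
      · rw [integral_cpow_mul_unitOf_mul_cpow U hd, hΦ n U d hd, h, smul_smul]
        congr 1
        push_cast
        ring
    | zero => simp
    | add X Y hX hY =>
      simp only [mul_add, add_mul, map_add]
      exact ⟨hX.1.add hY.1, by rw [integral_add hX.1 hY.1, hX.2, hY.2]⟩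
    | smul b X hX =>
      simp only [mul_smul_comm, smul_mul_assoc, map_smul]
      exact ⟨hX.1.smul b, by rw [integral_smul, hX.2]⟩

theorem IsMultiplier.existsUnique_represents (hΦ : IsMultiplier Φ a c)
    (hc : IsPosDefFun fun t => (c t : ℂ)) (h0 : c 0 = 1) (heven : ∀ t, c (-t) = c t) :
    ∃! ν : Measure ℝ, IsSymmProb ν ∧ Represents Φ a ν := by
  obtain ⟨ν, hν, hcf⟩ := hc.exists_charFun_eq (by simp [h0])
  refine ⟨ν, ⟨⟨hν, ?_⟩, hΦ.represents_iff.2 hcf⟩, ?_⟩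
  · have : IsProbabilityMeasure (ν.map fun s => -s) :=
      Measure.isProbabilityMeasure_map measurable_neg.aemeasurable
    refine Measure.ext_of_charFun (funext fun t => ?_)
    have h := charFun_map_mul (μ := ν) (-1) t
    simp only [neg_one_mul] at h
    rw [h, hcf]
    simp only [heven]
  · rintro ν' ⟨hν', hrep⟩
    have := hν'.isProb
    exact Measure.ext_of_charFun ((hΦ.represents_iff.1 hrep).trans hcf.symm)

end Multiplier

/-! ### Standard monotone functions: continuity and the transformation `T`. -/

section StandardMonotone

open Matrix (diagonal)

theorem cfc_ofSpectrum {n : ℕ} (g : ℝ → ℝ) (U : unitary (Mat n)) (d : Fin n → ℝ) :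
    cfc g (ofSpectrum U d) = ofSpectrum U fun i => g (d i) :=
  cfc_real_conj_diagonal U d g

theorem posDef_cfc {n : ℕ} {g : ℝ → ℝ} (hg : ∀ x : ℝ, 0 < x → 0 < g x) {A : Mat n}
    (hA : A.PosDef) : (cfc g A).PosDef := by
  obtain ⟨U, d, hd, rfl⟩ := exists_eq_ofSpectrum hA
  rw [cfc_ofSpectrum]
  exact posDef_ofSpectrum U fun i => hg _ (hd i)

theorem inv_le_inv_of_posDef {n : ℕ} {A B : Mat n} (hA : A.PosDef) (hB : B.PosDef) (h : A ≤ B) :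
    B⁻¹ ≤ A⁻¹ := by
  have := CStarAlgebra.inv_le_inv (a := hA.isUnit.unit) (b := hB.isUnit.unit)
    hA.posSemidef.nonneg h
  rwa [Matrix.coe_units_inv, Matrix.coe_units_inv] at this

namespace IsStandardMonotone

variable {f : ℝ → ℝ}

theorem monotoneOn (hf : IsStandardMonotone f) : MonotoneOn f (Set.Ioi 0) := by
  intro x hx y hy hxy
  have h (z : ℝ) : ofSpectrum (1 : unitary (Mat 1)) (fun _ => z) = diagonal fun _ => (z : ℂ) := by
    simp [ofSpectrum]
  have hle : ofSpectrum (1 : unitary (Mat 1)) (fun _ => x) ≤ ofSpectrum 1 fun _ => y := by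
    rw [Matrix.le_iff, h, h, Matrix.diagonal_sub]
    exact Matrix.PosSemidef.diagonal fun i => by
      simpa using hxy
  have h1 := hf.matrixMonotone 1 _ _ (posDef_ofSpectrum 1 fun _ => hx)
    (posDef_ofSpectrum 1 fun _ => hy) hle
  rw [cfc_ofSpectrum, cfc_ofSpectrum, h, h, Matrix.le_iff, Matrix.diagonal_sub] at h1
  simpa using h1.diag_nonneg (i := 0)

/-- Löwner theory is not needed: `f` is increasing while `f x / x = f x⁻¹` is decreasing, so `f y`
lies between `min 1 (y / x) * f x` and `max 1 (y / x) * f x`. -/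
theorem continuousOn (hf : IsStandardMonotone f) : ContinuousOn f (Set.Ioi 0) := by
  have hup {x y : ℝ} (hx : 0 < x) (hxy : x ≤ y) : f y ≤ y / x * f x := by
    have hy : 0 < y := hx.trans_le hxy
    have h := hf.monotoneOn (Set.mem_Ioi.2 (inv_pos.2 hy)) (Set.mem_Ioi.2 (inv_pos.2 hx))
      (inv_anti₀ hx hxy)
    rw [hf.symm x hx, hf.symm y hy, ← mul_assoc, div_mul_cancel₀ _ hx.ne']
    exact mul_le_mul_of_nonneg_left h hy.le
  intro x hx
  have hx0 : (0 : ℝ) < x := hx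
  refine ContinuousAt.continuousWithinAt ?_
  have hlo : Filter.Tendsto (fun y => min 1 (y / x) * f x) (nhds x) (nhds (f x)) := by
    have : ContinuousAt (fun y => min 1 (y / x) * f x) x := by fun_prop
    simpa [ContinuousAt, hx0.ne'] using this
  have hhi : Filter.Tendsto (fun y => max 1 (y / x) * f x) (nhds x) (nhds (f x)) := by
    have : ContinuousAt (fun y => max 1 (y / x) * f x) x := by fun_prop
    simpa [ContinuousAt, hx0.ne'] using this
  have hfx := hf.pos x hx0
  refine tendsto_of_tendsto_of_tendsto_of_le_of_le' hlo hhi ?_ ?_ <;>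
    filter_upwards [lt_mem_nhds hx0] with y hy
  · obtain hxy | hxy := le_total x y
    · have h1 := hf.monotoneOn hx (Set.mem_Ioi.2 hy) hxy
      rw [min_eq_left ((one_le_div hx0).2 hxy), one_mul]
      exact h1
    · have h1 := hup hy hxy
      rw [min_eq_right ((div_le_one hx0).2 hxy)]
      calc y / x * f x ≤ y / x * (x / y * f y) := by gcongr
        _ = f y := by field_simp
  · obtain hxy | hxy := le_total x y
    · rw [max_eq_right ((one_le_div hx0).2 hxy)]
      exact hup hx0 hxy
    · rw [max_eq_left ((div_le_one hx0).2 hxy), one_mul]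
      exact hf.monotoneOn (Set.mem_Ioi.2 hy) hx hxy

theorem continuous_comp_exp (hf : IsStandardMonotone f) :
    Continuous fun t => f (Real.exp t) :=
  hf.continuousOn.comp_continuous Real.continuous_exp fun t => Real.exp_pos t

theorem T_eq (hf : IsStandardMonotone f) {x : ℝ} (hx : 0 < x) : T f x = (f x⁻¹)⁻¹ := by
  have := (hf.pos _ (inv_pos.2 hx)).ne'
  rw [T, hf.symm x hx]
  field_simp

theorem cfc_T (hf : IsStandardMonotone f) {n : ℕ} {A : Mat n} (hA : A.PosDef) :
    cfc (T f) A = (cfc f A⁻¹)⁻¹ := by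
  obtain ⟨U, d, hd, rfl⟩ := exists_eq_ofSpectrum hA
  rw [inv_ofSpectrum U hd, cfc_ofSpectrum, cfc_ofSpectrum,
    inv_ofSpectrum U fun i => hf.pos _ (inv_pos.2 (hd i))]
  congr 1
  ext i
  exact hf.T_eq (hd i)

/-- Since `T f` at `A` is `(f (A⁻¹))⁻¹`, two order-reversing inversions surround a monotone map. -/
protected theorem T (hf : IsStandardMonotone f) : IsStandardMonotone (T f) where
  pos x hx := div_pos hx (hf.pos x hx)
  matrixMonotone n A B hA hB hAB := by
    rw [hf.cfc_T hA, hf.cfc_T hB]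
    exact inv_le_inv_of_posDef (posDef_cfc hf.pos hB.inv) (posDef_cfc hf.pos hA.inv)
      (hf.matrixMonotone n _ _ hB.inv hA.inv (inv_le_inv_of_posDef hA hB hAB))
  map_one := by simp [T, hf.map_one]
  symm x hx := by
    have := (hf.pos x hx).ne'
    rw [hf.T_eq (inv_pos.2 hx), inv_inv, T, div_eq_mul_inv]

theorem map_exp_neg (hf : IsStandardMonotone f) (t : ℝ) :
    f (Real.exp (-t)) / √(Real.exp (-t)) = f (Real.exp t) / √(Real.exp t) := by
  have h1 : √(Real.exp t) ≠ 0 := (Real.sqrt_pos.2 (Real.exp_pos t)).ne'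
  have h2 := Real.sq_sqrt (Real.exp_pos t).le
  rw [hf.symm _ (Real.exp_pos t), Real.exp_neg, Real.sqrt_inv]
  field_simp
  rw [h2]
  ring

end IsStandardMonotone

end StandardMonotone

/-! ### Fisher operators as multipliers. -/

section Fisher

variable {f : ℝ → ℝ}

/-- Pulling out the geometric mean of the eigenvalues leaves a function of their log-difference
alone; this is why `Real.sqrt` is the reference function of the order. -/
theorem mul_map_div_eq {x y : ℝ} (f : ℝ → ℝ) (hx : 0 < x) (hy : 0 < y) :
    y * f (x / y) = √x * √y * (f (Real.exp (Real.log x - Real.log y)) /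
      √(Real.exp (Real.log x - Real.log y))) := by
  have hx' : √x ≠ 0 := (Real.sqrt_pos.2 hx).ne'
  have hy' : √y ≠ 0 := (Real.sqrt_pos.2 hy).ne'
  have h2 := Real.sq_sqrt hy.le
  rw [Real.exp_sub, Real.exp_log hx, Real.exp_log hy, Real.sqrt_div hx.le]
  field_simp
  rw [h2]
  ring

theorem isMultiplier_fisherOp (f : ℝ → ℝ) :
    IsMultiplier (fun _ π => fisherOp f π) (1 / 2) fun t => f (Real.exp t) / √(Real.exp t) := by
  intro n U d hd j k
  simp only
  rw [fisherOp_unitOf f hd, mul_map_div_eq f (hd j) (hd k), Real.sqrt_eq_rpow (d j),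
    Real.sqrt_eq_rpow (d k)]

theorem isMultiplier_fisherOpInv (hf : ∀ x : ℝ, 0 < x → 0 < f x) :
    IsMultiplier (fun _ π => fisherOpInv f π) (-(1 / 2))
      fun t => √(Real.exp t) / f (Real.exp t) := by
  intro n U d hd j k
  simp only
  rw [fisherOpInv_unitOf hf hd, mul_map_div_eq f (hd j) (hd k), Real.rpow_neg (hd j).le,
    Real.rpow_neg (hd k).le, ← Real.sqrt_eq_rpow, ← Real.sqrt_eq_rpow, mul_inv, mul_inv, inv_div]

theorem representsPlus_iff {ν : Measure ℝ} :
    RepresentsPlus f ν ↔ Represents (fun _ π => fisherOp f π) (1 / 2) ν := by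
  simp [RepresentsPlus, Represents]

theorem representsMinus_iff {ν : Measure ℝ} :
    RepresentsMinus f ν ↔ Represents (fun _ π => fisherOpInv f π) (-(1 / 2)) ν := by
  simp [RepresentsMinus, Represents, sub_eq_add_neg]

theorem memMPlus_iff (hf : IsStandardMonotone f) : MemMPlus f ↔ Precedes f Real.sqrt := by
  have hc : Continuous fun t => f (Real.exp t) / √(Real.exp t) :=
    hf.continuous_comp_exp.div (by fun_prop) fun t => (Real.sqrt_pos.2 (Real.exp_pos t)).ne'
  rw [MemMPlus, and_iff_right hf]
  exact (isMultiplier_fisherOp f).isCP_iff hc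

theorem memMMinus_iff (hf : IsStandardMonotone f) : MemMMinus f ↔ Precedes Real.sqrt f := by
  have hc : Continuous fun t => √(Real.exp t) / f (Real.exp t) :=
    Continuous.div (by fun_prop) hf.continuous_comp_exp fun t => (hf.pos _ (Real.exp_pos t)).ne'
  rw [MemMMinus, and_iff_right hf]
  exact (isMultiplier_fisherOpInv hf.pos).isCP_iff hc

theorem sqrt_div_T {x : ℝ} (hx : 0 < x) : √x / T f x = f x / √x := by
  have hx' : √x ≠ 0 := (Real.sqrt_pos.2 hx).ne'
  rw [T, div_div_eq_mul_div, div_eq_div_iff hx.ne' hx']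
  linear_combination f x * Real.mul_self_sqrt hx.le

end Fisher

end QFisher

open QFisher in
theorem mainTheorem12 :
    (∀ f : ℝ → ℝ, IsStandardMonotone f → (MemMPlus f ↔ Precedes f Real.sqrt)) ∧
    (∀ f : ℝ → ℝ, IsStandardMonotone f → (MemMMinus f ↔ Precedes Real.sqrt f)) ∧
    (∀ f : ℝ → ℝ, MemMPlus f →
      ∃! ν : MeasureTheory.Measure ℝ, IsSymmProb ν ∧ RepresentsPlus f ν) ∧
    (∀ f : ℝ → ℝ, MemMMinus f →
      ∃! ν : MeasureTheory.Measure ℝ, IsSymmProb ν ∧ RepresentsMinus f ν) ∧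
    (∀ f : ℝ → ℝ, MemMPlus f →
      MemMMinus (T f) ∧
      ∀ νp νm : MeasureTheory.Measure ℝ,
        IsSymmProb νp → RepresentsPlus f νp →
        IsSymmProb νm → RepresentsMinus (T f) νm → νp = νm) := by
  refine ⟨fun f => memMPlus_iff, fun f => memMMinus_iff, fun f hf => ?_, fun f hf => ?_,
    fun f hf => ?_⟩
  · simp_rw [representsPlus_iff]
    exact (isMultiplier_fisherOp f).existsUnique_represents ((memMPlus_iff hf.1).1 hf)
      (by simp [hf.1.map_one]) hf.1.map_exp_neg
  · simp_rw [representsMinus_iff]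
    refine (isMultiplier_fisherOpInv hf.1.pos).existsUnique_represents
      ((memMMinus_iff hf.1).1 hf) (by simp [hf.1.map_one]) fun t => ?_
    rw [← inv_div, hf.1.map_exp_neg, inv_div]
  · have hT (t : ℝ) : √(Real.exp t) / T f (Real.exp t) = f (Real.exp t) / √(Real.exp t) :=
      sqrt_div_T (Real.exp_pos t)
    constructor
    · rw [memMMinus_iff hf.1.T, Precedes]
      simp_rw [hT]
      exact (memMPlus_iff hf.1).1 hf
    · intro νp νm hp hrp hm hrm
      have := hp.isProb
      have := hm.isProb
      have h1 := (isMultiplier_fisherOp f).represents_iff.1 (representsPlus_iff.1 hrp)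
      have h2 := (isMultiplier_fisherOpInv hf.1.T.pos).represents_iff.1 (representsMinus_iff.1 hrm)
      simp_rw [hT] at h2
      exact MeasureTheory.Measure.ext_of_charFun (h1.trans h2.symm)
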